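/- Let $\Omega$ be a connected Riemann surface with a holomorphic universal covering $p:\Delta\to\Omega$ by the unit disc $\Delta$, let $z_0,z_1\in\Omega$, and assume that $\Omega$ has a Green function $G=G_\Omega(\cdot,z_0)$ with pole $z_0$, i.e. a largest function among the negative harmonic functions $h$ on $\Omega\setminus\{z_0\}$ such that $h-\log|w|$ extends harmonically across $z_0$, where $w$ is a local coordinate with $w(z_0)=0$. Put $e^{G}(z_0)=0$. Let $u$ be a harmonic function on $\Omega$. Fix $y_1\in p^{-1}(z_1)$. Let $\mathrm{Deck}(\Delta\to\Omega)$ be the set of biholomorphic maps $\sigma:\Delta\to\Delta$ with $p\circ\sigma=p$, and let $\Phi:\mathrm{Deck}(\Delta\to\Omega)\to\pi_1(\Omega,z_1)$ be the map $\Phi(\sigma)=[p\circ\upsilon]$, where $\upsilon$ is any path in $\Delta$ from $y_1$ to $\sigma(y_1)$. For a function $w\ge 0$ on $\Omega$, say that a homomorphism $\chi:\pi_1(\Omega,z_1)\to\{|\zeta|=1\}$ is a character associated with $w$ if there is a holomorphic function $f$ on $\Delta$ with $|f|=w\circ p$ and $f\circ\sigma=\chi(\Phi(\sigma))\,f$ for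 all $\sigma\in\mathrm{Deck}(\Delta\to\Omega)$. Put $\tilde d=\frac{\partial-\bar\partial}{i}$. Then there is exactly one character $\chi_{z_0}$ associated with $e^{G_\Omega(\cdot,z_0)}$ and exactly one character $\chi_u$ associated with $e^{u}$. If $g\in\pi_1(\Omega,z_1)$ is represented by a piecewise smooth (that is, piecewise $C^1$) loop $\gamma$ based at $z_1$, then $$\chi_u(g)=\exp\Big(i\int_\gamma\tilde d u\Big),$$ and if moreover $z_0\notin\gamma$, then $$\chi_{z_0}(g)=\exp\Big(i\int_\gamma\tilde d G_\Omega(\cdot,z_0)\Big).$$ -/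

import Mathlib

open scoped Manifold ContDiff Topology

noncomputable section

/-- The open unit disc `Δ ⊆ ℂ`, with the Riemann surface structure of an open subset of `ℂ`. -/
def unitDisc : TopologicalSpace.Opens ℂ := ⟨Metric.ball 0 1, Metric.isOpen_ball⟩

instance unitDisc.pathConnectedSpace : PathConnectedSpace unitDisc :=
  isPathConnected_iff_pathConnectedSpace.mp
    ((convex_ball (0 : ℂ) 1).isPathConnected ⟨0, Metric.mem_ball_self one_pos⟩)

section RiemannSurface

variable {Ω : Type*} [TopologicalSpace Ω] [ChartedSpace ℂ Ω]

/-- `h` is harmonic on the open set `V` of the Riemann surface `Ω`: its expression in the local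
coordinate at each point of `V` is harmonic there. -/
def IsHarmonicOn (h : Ω → ℝ) (V : Set Ω) : Prop :=
  ∀ z ∈ V, InnerProductSpace.HarmonicAt (h ∘ (chartAt ℂ z).symm) (chartAt ℂ z z)

/-- `h` is a negative harmonic function on `Ω ∖ {z₀}` such that `h - log |w|` extends to a harmonic
function near `z₀`, where `w` is a local coordinate with `w(z₀) = 0`. The value of `h` at
`z₀` itself is irrelevant. -/
structure IsNegHarmonicWithLogPole (z₀ : Ω) (h : Ω → ℝ) : Prop where
  harmonic : IsHarmonicOn h {z₀}ᶜ
  neg : ∀ z, z ≠ z₀ → h z < 0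
  pole : ∃ H : ℂ → ℝ, InnerProductSpace.HarmonicAt H (chartAt ℂ z₀ z₀) ∧
    ∀ᶠ z in 𝓝[≠] z₀,
      h z = Real.log ‖chartAt ℂ z₀ z - chartAt ℂ z₀ z₀‖ + H (chartAt ℂ z₀ z)

/-- `G` is the (negative) Green function `G_Ω(·, z₀)` with pole `z₀`: the largest negative harmonic
function on `Ω ∖ {z₀}` with a logarithmic pole at `z₀`. -/
structure IsGreenFunction (z₀ : Ω) (G : Ω → ℝ) : Prop extends IsNegHarmonicWithLogPole z₀ G where
  maximal : ∀ h : Ω → ℝ, IsNegHarmonicWithLogPole z₀ h → ∀ z, z ≠ z₀ → h z ≤ G z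

open Classical in
/-- The function `exp G` for a function `G` with a logarithmic pole at `z₀` (so `exp G = 0` at
`z₀`). -/
def expWithPole (z₀ : Ω) (G : Ω → ℝ) (z : Ω) : ℝ := if z = z₀ then 0 else Real.exp (G z)

/-- The real differential `dh` at `z`. -/
def realDifferential (h : Ω → ℝ) (z : Ω) : TangentSpace 𝓘(ℝ, ℂ) z →L[ℝ] ℝ :=
  mfderiv 𝓘(ℝ, ℂ) 𝓘(ℝ, ℝ) h z

/-- Multiplication by `i` on the tangent space at `z` (a complex line). -/
def tangentI {z : Ω} (v : TangentSpace 𝓘(ℝ, ℂ) z) : TangentSpace 𝓘(ℝ, ℂ) z :=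
  (Complex.I * (show ℂ from v) : ℂ)

/-- `∂h`, the complex linear part of `dh`. -/
def del (h : Ω → ℝ) (z : Ω) (v : TangentSpace 𝓘(ℝ, ℂ) z) : ℂ :=
  ((realDifferential h z v : ℂ) - Complex.I * (realDifferential h z (tangentI v) : ℂ)) / 2

/-- `∂̄h`, the complex antilinear part of `dh`. -/
def delBar (h : Ω → ℝ) (z : Ω) (v : TangentSpace 𝓘(ℝ, ℂ) z) : ℂ :=
  ((realDifferential h z v : ℂ) + Complex.I * (realDifferential h z (tangentI v) : ℂ)) / 2

/-- The one-form `d̃h = (∂h - ∂̄h) / i`. -/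
def dTilde (h : Ω → ℝ) (z : Ω) (v : TangentSpace 𝓘(ℝ, ℂ) z) : ℂ :=
  (del h z v - delBar h z v) / Complex.I

/-- A path is piecewise smooth if `[0, 1]` is divided by finitely many points into closed intervals
on each of which it is continuously differentiable (one-sidedly at the end points). -/
def IsPiecewiseSmooth {a b : Ω} (γ : Path a b) : Prop :=
  ∃ (n : ℕ) (t : ℕ → ℝ), Monotone t ∧ t 0 = 0 ∧ t n = 1 ∧
    ∀ i < n, ContMDiffOn 𝓘(ℝ, ℝ) 𝓘(ℝ, ℂ) 1 γ.extend (Set.Icc (t i) (t (i + 1)))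

/-- The velocity vector of a path. -/
def velocity {a b : Ω} (γ : Path a b) (t : ℝ) : TangentSpace 𝓘(ℝ, ℂ) (γ.extend t) :=
  mfderiv 𝓘(ℝ, ℝ) 𝓘(ℝ, ℂ) γ.extend t (1 : ℝ)

/-- The line integral `∫_γ d̃h`. -/
def integralDTilde (h : Ω → ℝ) {a b : Ω} (γ : Path a b) : ℂ :=
  ∫ t in (0 : ℝ)..1, dTilde h (γ.extend t) (velocity γ t)

/-- `p : Δ → Ω` is a holomorphic covering map; as `Δ` is simply connected, it is then the universal
covering of the connected surface `Ω`. -/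
structure IsDiscUniversalCovering (p : unitDisc → Ω) : Prop where
  isCoveringMap : IsCoveringMap p
  holomorphic : MDifferentiable 𝓘(ℂ) 𝓘(ℂ) p

/-- The biholomorphic maps `σ : Δ → Δ` with `p ∘ σ = p`. -/
structure Deck (p : unitDisc → Ω) extends unitDisc ≃ unitDisc where
  holomorphic : MDifferentiable 𝓘(ℂ) 𝓘(ℂ) toEquiv
  holomorphic_symm : MDifferentiable 𝓘(ℂ) 𝓘(ℂ) toEquiv.symm
  comp_eq : ∀ y, p (toEquiv y) = p y

/-- The map `Φ : Deck(Δ → Ω) → π₁(Ω, z₁)`, `σ ↦ [p ∘ υ]`, where `υ` is a path in `Δ` from the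
base point `y₁` over `z₁` to `σ(y₁)` (all such paths are homotopic). -/
def deckToFundamentalGroup {p : unitDisc → Ω} (hp : IsDiscUniversalCovering p) {z₁ : Ω}
    {y₁ : unitDisc} (hy₁ : p y₁ = z₁) (σ : Deck p) : FundamentalGroup Ω z₁ :=
  FundamentalGroup.fromPath (Path.Homotopic.Quotient.mk
    (((PathConnectedSpace.somePath y₁ (σ.toEquiv y₁)).map hp.isCoveringMap.continuous).cast
      hy₁.symm ((σ.comp_eq y₁).trans hy₁).symm))

/-- `χ` is a character associated with the modulus `w : Ω → ℝ`: there is a holomorphic function `f`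
on `Δ` with `|f| = p^* w` and `σ^* f = χ(Φ(σ)) f` for every deck transformation `σ`. For
`w = exp(G_Ω(·, z₀))` and `w = exp u` this defines `χ_{z₀}` and `χ_u`. -/
def IsCharacterOf {p : unitDisc → Ω} (hp : IsDiscUniversalCovering p) {z₁ : Ω}
    {y₁ : unitDisc} (hy₁ : p y₁ = z₁) (w : Ω → ℝ) (χ : FundamentalGroup Ω z₁ →* Circle) : Prop :=
  ∃ f : unitDisc → ℂ, MDifferentiable 𝓘(ℂ) 𝓘(ℂ) f ∧ (∀ y, ‖f y‖ = w (p y)) ∧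
    ∀ (σ : Deck p) (y : unitDisc),
      f (σ.toEquiv y) = (χ (deckToFundamentalGroup hp hy₁ σ) : ℂ) * f y

end RiemannSurface

end

noncomputable section

open Metric Set Filter

/-! ### Holomorphic functions with prescribed modulus -/

/-! Existence: where `h` is harmonic, `h = Re F` locally, so `exp h = |exp F|`; at the pole `exp G =
|w exp F|`. The pullback `W` of the given function to the disc is therefore locally the modulus of a
holomorphic function not identically zero, and `exists_holomorphic_of_modulus_ball` makes it
globally `|f|`. By the maximum principle such an `f` is unique up to a unimodular constant. Since `f
∘ σ` has the same modulus, `f ∘ σ = c(σ) f`.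

The disc is simply connected, so `Φ` is a bijection: both `σ` and `g` are determined by the endpoint
in the fibre of the lift from `y₁` (`eq_of_monodromy_eq`, `exists_deckToFundamentalGroup_eq`).
Transporting `c` through `Φ` gives the character, and rescaling `f` does not change `c`.

Formula: along the lift `Γ` of a loop, `f` is locally a constant times `exp F`, whose logarithmic
derivative has imaginary part `d̃h` evaluated on the velocity. Integration gives `f(Γ 1) = f(Γ 0)
exp(ρ + i∫d̃h)` with `ρ` real; equal moduli at the two ends force `ρ = 0` (`lift_apply_one_eq`). As
`Γ 1 = σ(y₁)`, the quotient is the value of the character. -/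

/-- A holomorphic function of constant modulus one is locally a constant of modulus one. -/
theorem eventually_eq_const_of_norm_eq_one {q : ℂ → ℂ} {b : ℂ}
    (hd : ∀ᶠ z in 𝓝 b, DifferentiableAt ℂ q z) (hq : ∀ᶠ z in 𝓝 b, ‖q z‖ = 1) :
    ∀ᶠ z in 𝓝 b, q z = q b := by
  refine Complex.eventually_eq_of_isLocalMax_norm hd ?_
  filter_upwards [hq] with z hz
  simp [hz, hq.self_of_nhds]

/-- Two germs of holomorphic functions of the same modulus, the second nonvanishing, differ by a
constant of modulus one. -/
theorem AnalyticAt.exists_unimodular_mul_of_norm_eq {f g : ℂ → ℂ} {b : ℂ} (hf : AnalyticAt ℂ f b)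
    (hg : AnalyticAt ℂ g b) (h0 : g b ≠ 0) (h : ∀ᶠ z in 𝓝 b, ‖f z‖ = ‖g z‖) :
    ∃ c : ℂ, ‖c‖ = 1 ∧ ∀ᶠ z in 𝓝 b, f z = c * g z := by
  have hg0 := hg.continuousAt.eventually_ne h0
  refine ⟨f b / g b, ?_, ?_⟩
  · rw [norm_div, h.self_of_nhds, div_self (norm_ne_zero_iff.mpr h0)]
  · have hq : ∀ᶠ z in 𝓝 b, f z / g z = f b / g b := by
      refine eventually_eq_const_of_norm_eq_one (q := fun z ↦ f z / g z) ?_ ?_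
      · filter_upwards [hf.eventually_analyticAt, hg.eventually_analyticAt, hg0] with z h1 h2 h3
        exact h1.differentiableAt.div h2.differentiableAt h3
      · filter_upwards [h, hg0] with z h1 h2
        rw [norm_div, h1, div_self (norm_ne_zero_iff.mpr h2)]
    filter_upwards [hq, hg0] with z h1 h2
    rw [← h1, div_mul_cancel₀ _ h2]

/-- Two holomorphic functions of the same modulus on a connected open set differ by a constant of
modulus one. -/
theorem exists_unimodular_mul_of_norm_eqOn {f g : ℂ → ℂ} {U : Set ℂ} (hU : IsOpen U)
    (hc : IsPreconnected U) (hf : DifferentiableOn ℂ f U) (hg : DifferentiableOn ℂ g U)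
    (h : ∀ z ∈ U, ‖f z‖ = ‖g z‖) : ∃ c : ℂ, ‖c‖ = 1 ∧ ∀ z ∈ U, f z = c * g z := by
  by_cases h0 : ∀ z ∈ U, g z = 0
  · exact ⟨1, by simp, fun z hz ↦ by simpa [h0 z hz] using h z hz⟩
  push Not at h0
  obtain ⟨b, hb, hgb⟩ := h0
  have hfa := hf.analyticOnNhd hU
  have hga := hg.analyticOnNhd hU
  obtain ⟨c, hc1, hc2⟩ := (hfa b hb).exists_unimodular_mul_of_norm_eq (hga b hb) hgb
    (by filter_upwards [hU.mem_nhds hb] with z hz using h z hz)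
  exact ⟨c, hc1, hfa.eqOn_of_preconnected_of_eventuallyEq
    (fun z hz ↦ analyticAt_const.mul (hga z hz)) hc hb hc2⟩

/-- `W` is near `y` the modulus of a holomorphic function which does not vanish identically. -/
def IsHolomorphicModulusAt (W : ℂ → ℝ) (y : ℂ) : Prop :=
  (∃ g : ℂ → ℂ, AnalyticAt ℂ g y ∧ ∀ᶠ z in 𝓝 y, ‖g z‖ = W z) ∧ ∀ᶠ z in 𝓝[≠] y, W z ≠ 0

theorem IsHolomorphicModulusAt.congr {W W' : ℂ → ℝ} {y : ℂ} (h : IsHolomorphicModulusAt W y)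
    (hW : W =ᶠ[𝓝 y] W') : IsHolomorphicModulusAt W' y := by
  obtain ⟨⟨g, hg, hgW⟩, h0⟩ := h
  refine ⟨⟨g, hg, ?_⟩, ?_⟩
  · filter_upwards [hgW, hW] with z h1 h2 using h1.trans h2
  · filter_upwards [h0, hW.filter_mono nhdsWithin_le_nhds] with z h1 h2 using h2 ▸ h1

theorem IsHolomorphicModulusAt.div_pow {W : ℂ → ℝ} {y a : ℂ} (h : IsHolomorphicModulusAt W y)
    (hya : y ≠ a) (n : ℕ) : IsHolomorphicModulusAt (fun z ↦ W z / ‖z - a‖ ^ n) y := by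
  obtain ⟨⟨g, hg, hgW⟩, h0⟩ := h
  have hne : ∀ᶠ z in 𝓝 y, z ≠ a := eventually_ne_nhds hya
  refine ⟨⟨fun z ↦ g z / (z - a) ^ n, ?_, ?_⟩, ?_⟩
  · exact hg.div ((analyticAt_id.sub analyticAt_const).pow n) (pow_ne_zero _ (sub_ne_zero.mpr hya))
  · filter_upwards [hgW] with z h1
    simp [h1]
  · filter_upwards [h0, hne.filter_mono nhdsWithin_le_nhds] with z h1 h2
    exact div_ne_zero h1 (pow_ne_zero _ (norm_ne_zero_iff.mpr (sub_ne_zero.mpr h2)))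

/-- Without zeros `log W` is harmonic, hence `Re F` on the whole ball, and `exp F` has modulus `W`.
-/
theorem exists_holomorphic_of_modulus_ne_zero {W : ℂ → ℝ} {x : ℂ} {r : ℝ}
    (hW : ∀ y ∈ ball x r, IsHolomorphicModulusAt W y) (h0 : ∀ y ∈ ball x r, W y ≠ 0) :
    ∃ f : ℂ → ℂ, DifferentiableOn ℂ f (ball x r) ∧ ∀ z ∈ ball x r, ‖f z‖ = W z := by
  have hh : InnerProductSpace.HarmonicOnNhd (fun z ↦ Real.log (W z)) (ball x r) := by
    intro y hy
    obtain ⟨⟨g, hg, hgW⟩, -⟩ := hW y hy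
    have hgy : g y ≠ 0 := norm_ne_zero_iff.mp (hgW.self_of_nhds ▸ h0 y hy)
    refine (InnerProductSpace.harmonicAt_congr_nhds ?_).mp (hg.harmonicAt_log_norm hgy)
    filter_upwards [hgW] with z hz using by rw [hz]
  obtain ⟨F, hF, hFe⟩ := hh.exists_analyticOnNhd_ball_re_eq
  refine ⟨fun z ↦ Complex.exp (F z), fun z hz ↦
    (hF z hz).differentiableAt.cexp.differentiableWithinAt, fun z hz ↦ ?_⟩
  have hpos : 0 < W z := by
    obtain ⟨⟨g, -, hgW⟩, -⟩ := hW z hz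
    exact lt_of_le_of_ne (hgW.self_of_nhds ▸ norm_nonneg _) (h0 z hz).symm
  have := hFe hz
  simp only at this
  rw [Complex.norm_exp, this, Real.exp_log hpos]

/-- Zeros are divided out one at a time; `W` is quantified inside because each division changes it.
-/
theorem exists_holomorphic_of_modulus_finite {x : ℂ} {r : ℝ} (S : Finset ℂ) :
    ∀ W : ℂ → ℝ, (∀ y ∈ ball x r, IsHolomorphicModulusAt W y) →
      (∀ y ∈ ball x r, W y = 0 → y ∈ S) →
      ∃ f : ℂ → ℂ, DifferentiableOn ℂ f (ball x r) ∧ ∀ z ∈ ball x r, ‖f z‖ = W z := by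
  induction S using Finset.induction_on with
  | empty =>
    intro W hW h0
    exact exists_holomorphic_of_modulus_ne_zero hW fun y hy h ↦ by simpa using h0 y hy h
  | insert a S ha ih =>
    intro W hW h0
    by_cases hna : a ∈ ball x r ∧ W a = 0
    swap
    · refine ih W hW fun y hy h ↦ ?_
      rcases Finset.mem_insert.mp (h0 y hy h) with rfl | h'
      · exact absurd ⟨hy, h⟩ hna
      · exact h'
    obtain ⟨har, hWa⟩ := hna
    obtain ⟨⟨g, hg, hgW⟩, hne⟩ := hW a har
    have hgne : ¬ ∀ᶠ z in 𝓝 a, g z = 0 := by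
      intro hz
      have : ∀ᶠ z in 𝓝[≠] a, False := by
        filter_upwards [hne, (hz.and hgW).filter_mono nhdsWithin_le_nhds] with z h1 h2
        exact h1 (by rw [← h2.2, h2.1, norm_zero])
      exact this.exists.elim fun _ h ↦ h
    obtain ⟨n, k, hk, hka, hgk⟩ := hg.exists_eventuallyEq_pow_smul_nonzero_iff.mpr hgne
    have hn : n ≠ 0 := by
      rintro rfl
      have h1 := hgk.self_of_nhds
      have h2 := hgW.self_of_nhds
      rw [hWa, h1] at h2
      simp [hka] at h2
    classical
    -- Near `a`, `g = (z - a)^n k` with `k a ≠ 0`, so `‖k a‖` is the continuous value of the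
    -- quotient at `a`, and `a` is no longer a zero.
    set W' : ℂ → ℝ := fun z ↦ if z = a then ‖k a‖ else W z / ‖z - a‖ ^ n with hW'
    have hkW : ∀ᶠ z in 𝓝 a, ‖k z‖ = W' z := by
      filter_upwards [hgk, hgW] with z h1 h2
      by_cases hza : z = a
      · simp [hW', hza]
      · have : ‖z - a‖ ≠ 0 := norm_ne_zero_iff.mpr (sub_ne_zero.mpr hza)
        simp only [hW', hza, if_false]
        rw [← h2, h1, norm_smul, norm_pow]
        field_simp
    have h1 : ∀ y ∈ ball x r, IsHolomorphicModulusAt W' y := by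
      intro y hy
      by_cases hya : y = a
      · subst hya
        refine ⟨⟨k, hk, hkW⟩, ?_⟩
        filter_upwards [(hkW.and (hk.continuousAt.eventually_ne hka)).filter_mono
          nhdsWithin_le_nhds] with z h1
        rw [← h1.1]
        exact norm_ne_zero_iff.mpr h1.2
      · refine ((hW y hy).div_pow hya n).congr ?_
        filter_upwards [eventually_ne_nhds hya] with z hz
        simp [hW', hz]
    have h2 : ∀ y ∈ ball x r, W' y = 0 → y ∈ S := by
      intro y hy h
      by_cases hya : y = a
      · simp [hW', hya, hka] at h
      · have : ‖y - a‖ ≠ 0 := norm_ne_zero_iff.mpr (sub_ne_zero.mpr hya)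
        simp only [hW', hya, if_false, div_eq_zero_iff, pow_eq_zero_iff hn, this, or_false] at h
        exact (Finset.mem_insert.mp (h0 y hy h)).resolve_left hya
    obtain ⟨f, hf, hfW⟩ := ih W' h1 h2
    refine ⟨fun z ↦ (z - a) ^ n * f z, by fun_prop, fun z hz ↦ ?_⟩
    rw [norm_mul, norm_pow, hfW z hz]
    by_cases hza : z = a
    · simp [hza, hn, hWa]
    · have : ‖z - a‖ ≠ 0 := norm_ne_zero_iff.mpr (sub_ne_zero.mpr hza)
      simp only [hW', hza, if_false]
      field_simp

/-- The zeros of a modulus are finite in number on compact sets. -/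
theorem finite_zeros_of_modulus {W : ℂ → ℝ} {K : Set ℂ} (hK : IsCompact K)
    (hW : ∀ y ∈ K, ∀ᶠ z in 𝓝[≠] y, W z ≠ 0) : {z ∈ K | W z = 0}.Finite := by
  obtain ⟨t, -, ht⟩ := hK.elim_nhds_subcover (fun y ↦ {z | z ≠ y → W z ≠ 0})
    fun y hy ↦ eventually_nhdsWithin_iff.mp (hW y hy)
  refine t.finite_toSet.subset fun z hz ↦ ?_
  obtain ⟨y, hy, hzy⟩ := mem_iUnion₂.mp (ht hz.1)
  by_cases h : z = y
  · exact h ▸ hy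
  · exact absurd hz.2 (hzy h)

/-- A function on the unit disc which is locally the modulus of a holomorphic function is globally
the modulus of a holomorphic function. -/
theorem exists_holomorphic_of_modulus_ball {W : ℂ → ℝ}
    (hW : ∀ y ∈ ball (0 : ℂ) 1, IsHolomorphicModulusAt W y) :
    ∃ f : ℂ → ℂ, DifferentiableOn ℂ f (ball 0 1) ∧ ∀ z ∈ ball (0 : ℂ) 1, ‖f z‖ = W z := by
  have hex : ∀ r < (1 : ℝ), ∃ f : ℂ → ℂ, DifferentiableOn ℂ f (ball 0 r) ∧
      ∀ z ∈ ball (0 : ℂ) r, ‖f z‖ = W z := fun r hr ↦ by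
    have hfin := finite_zeros_of_modulus (W := W) (isCompact_closedBall (0 : ℂ) r)
      fun y hy ↦ (hW y (closedBall_subset_ball hr hy)).2
    exact exists_holomorphic_of_modulus_finite hfin.toFinset W
      (fun y hy ↦ hW y (ball_subset_ball hr.le hy))
      fun y hy h ↦ by simpa using ⟨(mem_ball_zero_iff.mp hy).le, h⟩
  obtain ⟨b, hb, hWb⟩ : ∃ b ∈ ball (0 : ℂ) (1 / 2), W b ≠ 0 := by
    have h1 := (hW 0 (by simp)).2
    have h2 : ∀ᶠ z in 𝓝[≠] (0 : ℂ), z ∈ ball (0 : ℂ) (1 / 2) :=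
      nhdsWithin_le_nhds (ball_mem_nhds _ (by norm_num))
    exact (h2.and h1).exists
  -- Prescribing the value at `b` removes the unimodular freedom, so the functions on concentric
  -- discs agree. Radii outside the range get the dummy `0`.
  have hex' : ∀ r : ℝ, ∃ f : ℂ → ℂ, 1 / 2 ≤ r → r < 1 → DifferentiableOn ℂ f (ball 0 r) ∧
      (∀ z ∈ ball (0 : ℂ) r, ‖f z‖ = W z) ∧ f b = W b := fun r ↦ by
    by_cases hr : 1 / 2 ≤ r ∧ r < 1
    swap
    · exact ⟨0, fun h1 h2 ↦ absurd ⟨h1, h2⟩ hr⟩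
    obtain ⟨f, hf, hfW⟩ := hex r hr.2
    have hbr := hfW b (ball_subset_ball hr.1 hb)
    have hfb : f b ≠ 0 := norm_ne_zero_iff.mp (hbr ▸ hWb)
    refine ⟨fun z ↦ (‖f b‖ / f b) * f z, fun _ _ ↦ ⟨by fun_prop, fun z hz ↦ ?_, ?_⟩⟩
    · rw [norm_mul, norm_div, Complex.norm_real, norm_norm, div_self (norm_ne_zero_iff.mpr hfb),
        one_mul, hfW z hz]
    · simp only [div_mul_cancel₀ _ hfb, hbr]
  choose F hF using hex'
  have hagree : ∀ r s, 1 / 2 ≤ r → r ≤ s → s < 1 → ∀ z ∈ ball (0 : ℂ) r, F r z = F s z := by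
    intro r s hr hrs hs
    obtain ⟨h1, h2, h3⟩ := hF r hr (hrs.trans_lt hs)
    obtain ⟨h1', h2', h3'⟩ := hF s (hr.trans hrs) hs
    obtain ⟨c, -, hc⟩ := exists_unimodular_mul_of_norm_eqOn isOpen_ball
      (convex_ball (0 : ℂ) r).isPreconnected h1 (h1'.mono (ball_subset_ball hrs))
      fun z hz ↦ by rw [h2 z hz, h2' z (ball_subset_ball hrs hz)]
    have hcb := hc b (ball_subset_ball hr hb)
    rw [h3, h3'] at hcb
    have hc1 : c = 1 := by
      have : (W b : ℂ) ≠ 0 := by exact_mod_cast hWb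
      exact (mul_right_cancel₀ this (by rw [one_mul]; exact hcb)).symm
    intro z hz
    rw [hc z hz, hc1, one_mul]
  -- This radius exceeds `‖z‖`, stays below `1` and is at least `1/2`.
  set f : ℂ → ℂ := fun z ↦ F ((1 + ‖z‖) / 2) z with hf
  have hfF : ∀ s, 1 / 2 ≤ s → s < 1 → ∀ z ∈ ball (0 : ℂ) s, f z = F s z := by
    intro s hs hs1 z hz
    have hz' := mem_ball_zero_iff.mp hz
    have hn := norm_nonneg z
    rcases le_total ((1 + ‖z‖) / 2) s with h | h
    · exact hagree _ _ (by linarith) h hs1 z (mem_ball_zero_iff.mpr (by linarith))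
    · exact (hagree _ _ hs h (by linarith) z hz).symm
  have hmain : ∀ z ∈ ball (0 : ℂ) 1, DifferentiableAt ℂ f z ∧ ‖f z‖ = W z := by
    intro z hz
    have hz' := mem_ball_zero_iff.mp hz
    have hn := norm_nonneg z
    have hs : 1 / 2 ≤ (1 + ‖z‖) / 2 := by linarith
    have hs1 : (1 + ‖z‖) / 2 < 1 := by linarith
    have hzs : z ∈ ball (0 : ℂ) ((1 + ‖z‖) / 2) := mem_ball_zero_iff.mpr (by linarith)
    obtain ⟨h1, h2, -⟩ := hF _ hs hs1
    refine ⟨?_, by rw [hfF _ hs hs1 z hzs, h2 z hzs]⟩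
    refine (h1.differentiableAt (isOpen_ball.mem_nhds hzs)).congr_of_eventuallyEq ?_
    filter_upwards [isOpen_ball.mem_nhds hzs] with w hw using hfF _ hs hs1 w hw
  exact ⟨f, fun z hz ↦ (hmain z hz).1.differentiableWithinAt, fun z hz ↦ (hmain z hz).2⟩

/-- A harmonic function is locally the real part of a holomorphic function. -/
theorem InnerProductSpace.HarmonicAt.exists_analyticAt_re_eq {h : ℂ → ℝ} {a : ℂ}
    (hh : InnerProductSpace.HarmonicAt h a) :
    ∃ F : ℂ → ℂ, AnalyticAt ℂ F a ∧ ∀ᶠ z in 𝓝 a, (F z).re = h z := by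
  obtain ⟨ε, hε, hs⟩ := Metric.eventually_nhds_iff_ball.mp hh.eventually
  obtain ⟨F, hF, hFe⟩ :=
    InnerProductSpace.HarmonicOnNhd.exists_analyticOnNhd_ball_re_eq (z := a) (R := ε) hs
  exact ⟨F, hF a (mem_ball_self hε), by
    filter_upwards [ball_mem_nhds a hε] with z hz using hFe hz⟩

/-- If `P` is holomorphic and not locally constant at `F y`, and `F` is continuous, injective near
`y` with `P ∘ F` holomorphic, then `F` is holomorphic at `y`. -/
theorem analyticAt_of_comp_analyticAt {P F : ℂ → ℂ} {y : ℂ} (hP : AnalyticAt ℂ P (F y))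
    (hPn : ¬ ∀ᶠ z in 𝓝 (F y), P z = P (F y)) (hF : ∀ᶠ z in 𝓝 y, ContinuousAt F z)
    (hinj : ∀ᶠ z in 𝓝[≠] y, F z ≠ F y) (hPF : AnalyticAt ℂ (fun z ↦ P (F z)) y) :
    AnalyticAt ℂ F y := by
  have hd : ∀ᶠ w in 𝓝[≠] F y, deriv P w ≠ 0 := by
    refine hP.deriv.eventually_eq_zero_or_eventually_ne_zero.resolve_left fun h0 ↦ hPn ?_
    obtain ⟨ε, hε, hs⟩ := Metric.eventually_nhds_iff_ball.mp (h0.and hP.eventually_analyticAt)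
    filter_upwards [ball_mem_nhds _ hε] with z hz
    exact (convex_ball (F y) ε).is_const_of_fderivWithin_eq_zero (𝕜 := ℂ)
      (fun w hw ↦ (hs w hw).2.differentiableAt.differentiableWithinAt)
      (fun w hw ↦ by
        rw [fderivWithin_of_isOpen isOpen_ball hw]
        ext
        simpa using (hs w hw).1) hz (mem_ball_self hε)
  have hFy : Tendsto F (𝓝[≠] y) (𝓝[≠] F y) :=
    tendsto_nhdsWithin_iff.mpr ⟨hF.self_of_nhds.tendsto.mono_left nhdsWithin_le_nhds, hinj⟩
  have hPa : ∀ᶠ w in 𝓝[≠] F y, AnalyticAt ℂ P w :=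
    hP.eventually_analyticAt.filter_mono nhdsWithin_le_nhds
  -- Away from `y`, `F` is a local inverse of `P` composed with `P ∘ F`; the point `y` is a
  -- removable singularity.
  refine Complex.analyticAt_of_differentiable_on_punctured_nhds_of_continuousAt ?_ hF.self_of_nhds
  filter_upwards [hFy.eventually hd, hFy.eventually hPa,
    (hPF.eventually_analyticAt.and hF).filter_mono nhdsWithin_le_nhds] with z h1 h2 h3
  have hs : HasStrictDerivAt P (deriv P (F z)) (F z) := h2.hasStrictDerivAt
  have hl := hs.hasStrictFDerivAt_equiv h1
  have hli := h3.2.eventually hl.eventually_left_inverse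
  have hloc : DifferentiableAt ℂ (hl.localInverse P _ _) (P (F z)) :=
    hl.to_localInverse.hasFDerivAt.differentiableAt
  refine (hloc.comp z h3.1.differentiableAt).congr_of_eventuallyEq ?_
  filter_upwards [hli] with w hw using hw.symm

/-! ### The unit disc as a Riemann surface -/

instance unitDisc.simplyConnectedSpace : SimplyConnectedSpace unitDisc :=
  have : ContractibleSpace (ball (0 : ℂ) 1) :=
    (convex_ball (0 : ℂ) 1).contractibleSpace ⟨0, mem_ball_self one_pos⟩
  inferInstanceAs (SimplyConnectedSpace (ball (0 : ℂ) 1))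

instance unitDisc.locallyPathConnectedSpace : LocallyPathConnectedSpace unitDisc :=
  unitDisc.isOpen.locallyPathConnectedSpace

open Classical in
/-- A left inverse of the inclusion `Δ → ℂ`. -/
def discRetract (z : ℂ) : unitDisc :=
  if h : z ∈ unitDisc then ⟨z, h⟩ else ⟨0, mem_ball_self one_pos⟩

@[simp]
theorem discRetract_coe (y : unitDisc) : discRetract y = y := by simp [discRetract]

theorem coe_discRetract {z : ℂ} (hz : z ∈ ball (0 : ℂ) 1) : (discRetract z : ℂ) = z :=
  congrArg Subtype.val (discRetract_coe ⟨z, hz⟩)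

theorem discRetract_comp_val : discRetract ∘ ((↑) : unitDisc → ℂ) = id :=
  funext discRetract_coe

theorem ball_mem_nhds_coe (y : unitDisc) : ball (0 : ℂ) 1 ∈ 𝓝 (y : ℂ) :=
  isOpen_ball.mem_nhds y.2

theorem nhds_coe_unitDisc (y : unitDisc) : 𝓝 (y : ℂ) = map (↑) (𝓝 y) :=
  (map_nhds_subtype_coe_eq_nhds y.2 (ball_mem_nhds_coe y)).symm

theorem tendsto_discRetract (y : unitDisc) : Tendsto discRetract (𝓝 (y : ℂ)) (𝓝 y) := by
  rw [nhds_coe_unitDisc, tendsto_map'_iff, discRetract_comp_val]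
  exact tendsto_id

theorem tendsto_discRetract_ne (y : unitDisc) :
    Tendsto discRetract (𝓝[≠] (y : ℂ)) (𝓝[≠] y) := by
  refine tendsto_nhdsWithin_iff.mpr
    ⟨(tendsto_discRetract y).mono_left nhdsWithin_le_nhds, ?_⟩
  filter_upwards [self_mem_nhdsWithin, nhdsWithin_le_nhds (ball_mem_nhds_coe y)] with z h1 h2 h3
  exact h1 (by rw [mem_singleton_iff, ← coe_discRetract h2, h3])

theorem mdifferentiableAt_unitDisc_iff {M : Type*} [TopologicalSpace M] [ChartedSpace ℂ M]
    {f : unitDisc → M} {y : unitDisc} :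
    MDifferentiableAt 𝓘(ℂ) 𝓘(ℂ) f y ↔
      MDifferentiableAt 𝓘(ℂ) 𝓘(ℂ) (f ∘ discRetract) (y : ℂ) := by
  have h := (differentiableWithinAt_localInvariantProp (I := 𝓘(ℂ)) (I' := 𝓘(ℂ))
    ).liftPropAt_iff_comp_subtype_val (f ∘ discRetract) y
  rw [Function.comp_assoc, discRetract_comp_val, Function.comp_id] at h
  exact h.symm

theorem mdifferentiable_unitDisc_iff {f : unitDisc → ℂ} :
    MDifferentiable 𝓘(ℂ) 𝓘(ℂ) f ↔ DifferentiableOn ℂ (f ∘ discRetract) (ball 0 1) := by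
  refine ⟨fun h z hz ↦ ?_, fun h y ↦ ?_⟩
  · exact (mdifferentiableAt_unitDisc_iff.mp (h ⟨z, hz⟩)).differentiableAt.differentiableWithinAt
  · exact mdifferentiableAt_unitDisc_iff.mpr
      (h.differentiableAt (ball_mem_nhds_coe y)).mdifferentiableAt

theorem mdifferentiable_unitDisc_of_differentiableOn {f : ℂ → ℂ}
    (hf : DifferentiableOn ℂ f (ball 0 1)) :
    MDifferentiable 𝓘(ℂ) 𝓘(ℂ) fun y : unitDisc ↦ f y :=
  mdifferentiable_unitDisc_iff.mpr (hf.congr fun z hz ↦ by simp [coe_discRetract hz])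

/-- The charts of the disc are the inclusion, so `F` and its composite with the inclusion have the
same coordinate expression. -/
theorem mdifferentiable_unitDisc_self_of_differentiableOn {F : unitDisc → unitDisc}
    (hc : Continuous F)
    (hF : DifferentiableOn ℂ (fun z ↦ (F (discRetract z) : ℂ)) (ball 0 1)) :
    MDifferentiable 𝓘(ℂ) 𝓘(ℂ) F := by
  have h := mdifferentiable_unitDisc_iff (f := fun y ↦ (F y : ℂ)) |>.mpr hF
  intro y
  exact ⟨hc.continuousWithinAt, (h y).2⟩

/-- Two holomorphic functions on the disc of the same modulus differ by a constant of modulus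
one. -/
theorem exists_unimodular_mul_of_norm_eq_unitDisc {f g : unitDisc → ℂ}
    (hf : MDifferentiable 𝓘(ℂ) 𝓘(ℂ) f) (hg : MDifferentiable 𝓘(ℂ) 𝓘(ℂ) g)
    (h : ∀ y, ‖f y‖ = ‖g y‖) : ∃ c : ℂ, ‖c‖ = 1 ∧ ∀ y, f y = c * g y := by
  obtain ⟨c, hc, hfg⟩ := exists_unimodular_mul_of_norm_eqOn isOpen_ball
    (convex_ball (0 : ℂ) 1).isPreconnected (mdifferentiable_unitDisc_iff.mp hf)
    (mdifferentiable_unitDisc_iff.mp hg) fun z _ ↦ h _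
  exact ⟨c, hc, fun y ↦ by simpa using hfg y y.2⟩

theorem expWithPole_of_ne {Ω : Type*} {z₀ z : Ω} (G : Ω → ℝ) (h : z ≠ z₀) :
    expWithPole z₀ G z = Real.exp (G z) := if_neg h

/-! ### Local holomorphic moduli on `Ω` and their pullback to the disc -/

section RiemannSurface

variable {Ω : Type*} [TopologicalSpace Ω] [ChartedSpace ℂ Ω]

/-- `w` is locally the modulus of a holomorphic function, expressed in the local coordinate. -/
def IsHolomorphicModulus (w : Ω → ℝ) : Prop :=
  ∀ z, (∃ F : ℂ → ℂ, AnalyticAt ℂ F (chartAt ℂ z z) ∧ ∀ᶠ x in 𝓝 z, ‖F (chartAt ℂ z x)‖ = w x) ∧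
    ∀ᶠ x in 𝓝[≠] z, w x ≠ 0

theorem tendsto_chartAt (z : Ω) : Tendsto (chartAt ℂ z) (𝓝 z) (𝓝 (chartAt ℂ z z)) :=
  (chartAt ℂ z).continuousAt (mem_chart_source ℂ z)

/-- A harmonic function is locally the real part of a holomorphic function of the coordinate. -/
theorem IsHarmonicOn.exists_re_eq {h : Ω → ℝ} {V : Set Ω} (hh : IsHarmonicOn h V) {z : Ω}
    (hz : z ∈ V) : ∃ F : ℂ → ℂ, AnalyticAt ℂ F (chartAt ℂ z z) ∧
      (∀ᶠ x in 𝓝 (chartAt ℂ z z), (F x).re = h ((chartAt ℂ z).symm x)) ∧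
      ∀ᶠ x in 𝓝 z, (F (chartAt ℂ z x)).re = h x := by
  obtain ⟨F, hF, hFe⟩ := (hh z hz).exists_analyticAt_re_eq
  refine ⟨F, hF, hFe, ?_⟩
  filter_upwards [(tendsto_chartAt z).eventually hFe,
    (chartAt ℂ z).open_source.mem_nhds (mem_chart_source ℂ z)] with x h1 h2
  rw [h1, Function.comp_apply, (chartAt ℂ z).left_inv h2]

theorem isHolomorphicModulus_exp {u : Ω → ℝ} (hu : IsHarmonicOn u univ) :
    IsHolomorphicModulus fun z ↦ Real.exp (u z) := by
  intro z
  obtain ⟨F, hF, -, hFe⟩ := hu.exists_re_eq (mem_univ z)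
  refine ⟨⟨fun x ↦ Complex.exp (F x), hF.cexp, ?_⟩, Eventually.of_forall fun x ↦
    (Real.exp_pos _).ne'⟩
  filter_upwards [hFe] with x hx
  rw [Complex.norm_exp, hx]

theorem isHolomorphicModulus_expWithPole [T1Space Ω] {z₀ : Ω} {G : Ω → ℝ}
    (hG : IsNegHarmonicWithLogPole z₀ G) : IsHolomorphicModulus (expWithPole z₀ G) := by
  intro z
  refine ⟨?_, ?_⟩
  · by_cases hz : z = z₀
    · subst hz
      obtain ⟨H, hH, hGH⟩ := hG.pole
      obtain ⟨F, hF, hFe⟩ := hH.exists_analyticAt_re_eq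
      refine ⟨fun x ↦ (x - chartAt ℂ z z) * Complex.exp (F x),
        (analyticAt_id.sub analyticAt_const).mul hF.cexp, ?_⟩
      filter_upwards [eventually_nhdsWithin_iff.mp hGH, (tendsto_chartAt z).eventually hFe,
        (chartAt ℂ z).open_source.mem_nhds (mem_chart_source ℂ z)] with x h1 h2 h3
      by_cases hx : x = z
      · simp [hx, expWithPole]
      · have hne : chartAt ℂ z x - chartAt ℂ z z ≠ 0 := sub_ne_zero.mpr fun h ↦
          hx ((chartAt ℂ z).injOn h3 (mem_chart_source ℂ z) h)
        rw [expWithPole_of_ne G hx, h1 hx, Real.exp_add, Real.exp_log (norm_pos_iff.mpr hne),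
          norm_mul, Complex.norm_exp, h2]
    · obtain ⟨F, hF, -, hFe⟩ := hG.harmonic.exists_re_eq (mem_compl_singleton_iff.mpr hz)
      refine ⟨fun x ↦ Complex.exp (F x), hF.cexp, ?_⟩
      filter_upwards [hFe, eventually_ne_nhds hz] with x hx hx0
      rw [Complex.norm_exp, hx, expWithPole_of_ne G hx0]
  · have : ∀ᶠ x in 𝓝[≠] z, x ≠ z₀ := by
      by_cases hz : z = z₀
      · exact hz ▸ self_mem_nhdsWithin
      · exact nhdsWithin_le_nhds (eventually_ne_nhds hz)
    filter_upwards [this] with x hx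
    rw [expWithPole_of_ne G hx]
    exact (Real.exp_pos _).ne'

variable {p : unitDisc → Ω}

/-- The expression of a covering map `p` in a local coordinate is holomorphic. -/
theorem IsDiscUniversalCovering.analyticAt_chart [IsManifold 𝓘(ℂ) ω Ω]
    (hp : IsDiscUniversalCovering p) {z : Ω} {y : unitDisc} (hy : p y ∈ (chartAt ℂ z).source) :
    AnalyticAt ℂ (fun x ↦ chartAt ℂ z (p (discRetract x))) (y : ℂ) := by
  have : IsManifold 𝓘(ℂ) 1 Ω := IsManifold.of_le (n := ω) le_top
  rw [Complex.analyticAt_iff_eventually_differentiableAt]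
  have hs : ∀ᶠ x in 𝓝 (y : ℂ), p (discRetract x) ∈ (chartAt ℂ z).source :=
    (hp.isCoveringMap.continuous.continuousAt.tendsto.comp (tendsto_discRetract y)).eventually
      ((chartAt ℂ z).open_source.mem_nhds hy)
  filter_upwards [hs, ball_mem_nhds_coe y] with x hx hxb
  have h1 : MDifferentiableAt 𝓘(ℂ) 𝓘(ℂ) (p ∘ discRetract) x :=
    mdifferentiableAt_unitDisc_iff.mp (hp.holomorphic ⟨x, hxb⟩)
  exact ((mdifferentiableAt_atlas (I := 𝓘(ℂ)) (chart_mem_atlas ℂ z) hx).comp x h1).differentiableAt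

theorem IsDiscUniversalCovering.eventually_ne (hp : IsDiscUniversalCovering p) (y : unitDisc) :
    ∀ᶠ x in 𝓝[≠] y, p x ≠ p y := by
  obtain ⟨e, he, rfl⟩ := hp.isCoveringMap.isLocalHomeomorph y
  filter_upwards [self_mem_nhdsWithin, nhdsWithin_le_nhds (e.open_source.mem_nhds he)]
    with x h1 h2 h3
  exact h1 (e.injOn h2 he h3)

/-- Local injectivity of `p` sends punctured neighbourhoods into punctured neighbourhoods, so
nonvanishing off the centre survives the pullback. -/
theorem IsHolomorphicModulus.comp [IsManifold 𝓘(ℂ) ω Ω] {w : Ω → ℝ} (hw : IsHolomorphicModulus w)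
    (hp : IsDiscUniversalCovering p) (y : unitDisc) :
    IsHolomorphicModulusAt (fun x ↦ w (p (discRetract x))) (y : ℂ) := by
  obtain ⟨⟨F, hF, hFe⟩, hne⟩ := hw (p y)
  have ht : Tendsto (fun x ↦ p (discRetract x)) (𝓝 (y : ℂ)) (𝓝 (p y)) :=
    hp.isCoveringMap.continuous.continuousAt.tendsto.comp (tendsto_discRetract y)
  have ht' : Tendsto (fun x ↦ p (discRetract x)) (𝓝[≠] (y : ℂ)) (𝓝[≠] (p y)) :=
    tendsto_nhdsWithin_iff.mpr ⟨ht.mono_left nhdsWithin_le_nhds,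
      (tendsto_discRetract_ne y).eventually (hp.eventually_ne y)⟩
  refine ⟨⟨fun x ↦ F (chartAt ℂ (p y) (p (discRetract x))), ?_, ht.eventually hFe⟩,
    ht'.eventually hne⟩
  exact AnalyticAt.fun_comp (by simpa using hF) (hp.analyticAt_chart (mem_chart_source ℂ _))

/-- A holomorphic function on the disc whose modulus is the pull back of a given modulus. -/
theorem IsHolomorphicModulus.exists_holomorphic [IsManifold 𝓘(ℂ) ω Ω] {w : Ω → ℝ}
    (hw : IsHolomorphicModulus w) (hp : IsDiscUniversalCovering p) :
    ∃ f : unitDisc → ℂ, MDifferentiable 𝓘(ℂ) 𝓘(ℂ) f ∧ ∀ y, ‖f y‖ = w (p y) := by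
  obtain ⟨f, hf, hfw⟩ := exists_holomorphic_of_modulus_ball fun y hy ↦ hw.comp hp ⟨y, hy⟩
  exact ⟨fun y ↦ f y, mdifferentiable_unitDisc_of_differentiableOn hf,
    fun y ↦ by simpa using hfw y y.2⟩

theorem IsHolomorphicModulus.exists_ne_zero [IsManifold 𝓘(ℂ) ω Ω] {w : Ω → ℝ}
    (hw : IsHolomorphicModulus w) (hp : IsDiscUniversalCovering p) : ∃ y, w (p y) ≠ 0 :=
  let ⟨x, hx⟩ := (hw.comp hp (discRetract 0)).2.exists
  ⟨discRetract x, hx⟩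

end RiemannSurface

section Deck

variable {Ω : Type*} [TopologicalSpace Ω] [ChartedSpace ℂ Ω] {p : unitDisc → Ω}

/-! ### Deck transformations and monodromy -/

/-- A continuous lift of a covering map through itself is holomorphic. -/
theorem IsDiscUniversalCovering.mdifferentiable_of_comp_eq [IsManifold 𝓘(ℂ) ω Ω]
    (hp : IsDiscUniversalCovering p) {F : unitDisc → unitDisc} (hF : Continuous F)
    (h : ∀ y, p (F y) = p y) : MDifferentiable 𝓘(ℂ) 𝓘(ℂ) F := by
  refine mdifferentiable_unitDisc_self_of_differentiableOn hF fun z hz ↦ ?_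
  obtain ⟨y, rfl⟩ : ∃ y : unitDisc, (y : ℂ) = z := ⟨⟨z, hz⟩, rfl⟩
  -- Since `p ∘ F = p`, the composite `P ∘ F` is a coordinate expression of `p`, hence holomorphic
  -- although `F` is so far only continuous.
  refine AnalyticAt.differentiableWithinAt (analyticAt_of_comp_analyticAt
    (P := fun x ↦ chartAt ℂ (p y) (p (discRetract x))) ?_ ?_ ?_ ?_ ?_)
  · simp only [discRetract_coe]
    exact hp.analyticAt_chart (by rw [h]; exact mem_chart_source ℂ _)
  · simp only [discRetract_coe]
    intro hc
    have h1 := (tendsto_discRetract_ne (F y)).eventually (hp.eventually_ne (F y))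
    have h2 : ∀ᶠ x in 𝓝 ((F y : unitDisc) : ℂ), p (discRetract x) ∈ (chartAt ℂ (p y)).source := by
      refine (hp.isCoveringMap.continuous.continuousAt.tendsto.comp
        (tendsto_discRetract (F y))).eventually ((chartAt ℂ (p y)).open_source.mem_nhds ?_)
      rw [h]
      exact mem_chart_source ℂ _
    obtain ⟨x, hx1, hx2, hx3⟩ := (h1.and ((hc.and h2).filter_mono nhdsWithin_le_nhds)).exists
    exact hx1 ((chartAt ℂ (p y)).injOn hx3 (by rw [h]; exact mem_chart_source ℂ _) hx2)
  · filter_upwards [ball_mem_nhds_coe y] with x hx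
    have : ContinuousAt discRetract x := by
      have := tendsto_discRetract ⟨x, hx⟩
      rwa [ContinuousAt, show discRetract x = ⟨x, hx⟩ from discRetract_coe ⟨x, hx⟩]
    exact continuous_subtype_val.continuousAt.comp (hF.continuousAt.comp this)
  · filter_upwards [(tendsto_discRetract_ne y).eventually (hp.eventually_ne y)] with x hx hxy
    rw [discRetract_coe] at hxy
    exact hx (by rw [← h, Subtype.ext hxy, h])
  · simp only [discRetract_coe, h]
    exact hp.analyticAt_chart (mem_chart_source ℂ _)

theorem Deck.ext_of_apply_eq (hp : IsDiscUniversalCovering p) {σ τ : Deck p} {y : unitDisc}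
    (h : σ.toEquiv y = τ.toEquiv y) : σ = τ := by
  have : σ.toEquiv = τ.toEquiv := DFunLike.coe_injective <|
    hp.isCoveringMap.eq_of_comp_eq σ.holomorphic.continuous τ.holomorphic.continuous
      (funext fun x ↦ (σ.comp_eq x).trans (τ.comp_eq x).symm) y h
  cases σ
  cases τ
  simpa using this

/-- Deck transformations act transitively on the fibres. -/
theorem IsDiscUniversalCovering.exists_deck [IsManifold 𝓘(ℂ) ω Ω]
    (hp : IsDiscUniversalCovering p) {y y' : unitDisc} (h : p y' = p y) :
    ∃ σ : Deck p, σ.toEquiv y = y' := by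
  have cov := hp.isCoveringMap
  obtain ⟨F, ⟨hFy, hF⟩, -⟩ :=
    cov.existsUnique_continuousMap_lifts ⟨p, cov.continuous⟩ y y' h
  obtain ⟨F', ⟨hFy', hF'⟩, -⟩ :=
    cov.existsUnique_continuousMap_lifts ⟨p, cov.continuous⟩ y' y h.symm
  have hF := congrFun hF
  have hF' := congrFun hF'
  simp only [Function.comp_apply, ContinuousMap.coe_mk] at hF hF'
  -- Both sides lift `p` through itself and agree at `y`.
  have h1 : F' ∘ F = id := cov.eq_of_comp_eq (F'.continuous.comp F.continuous) continuous_id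
    (funext fun x ↦ by simp [hF, hF']) y (by simp [hFy, hFy'])
  have h2 : F ∘ F' = id := cov.eq_of_comp_eq (F.continuous.comp F'.continuous) continuous_id
    (funext fun x ↦ by simp [hF, hF']) y' (by simp [hFy, hFy'])
  exact ⟨{  toFun := F
            invFun := F'
            left_inv := congrFun h1
            right_inv := congrFun h2
            holomorphic := hp.mdifferentiable_of_comp_eq F.continuous hF
            holomorphic_symm := hp.mdifferentiable_of_comp_eq F'.continuous hF'
            comp_eq := hF }, hFy⟩

variable {z₁ : Ω} {y₁ : unitDisc}

/-- The path used to define `Φ(σ)` is itself the lift of its projection; this makes `Φ` computable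
from endpoints. -/
theorem monodromy_deckToFundamentalGroup (hp : IsDiscUniversalCovering p) (hy₁ : p y₁ = z₁)
    (σ : Deck p) :
    (hp.isCoveringMap.monodromy (deckToFundamentalGroup hp hy₁ σ) ⟨y₁, hy₁⟩ : unitDisc) =
      σ.toEquiv y₁ := by
  have := hp.isCoveringMap.monodromy_eq_of_map_eq (γ := deckToFundamentalGroup hp hy₁ σ)
    (ex := ⟨y₁, hy₁⟩) (ey := ⟨σ.toEquiv y₁, (σ.comp_eq y₁).trans hy₁⟩)
    (Path.Homotopic.Quotient.mk (PathConnectedSpace.somePath y₁ (σ.toEquiv y₁))) rfl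
  rw [this]

/-- The monodromy at a point of a simply connected covering space determines the class of a
loop. -/
theorem eq_of_monodromy_eq (hp : IsDiscUniversalCovering p) (hy₁ : p y₁ = z₁)
    {g g' : FundamentalGroup Ω z₁}
    (h : (hp.isCoveringMap.monodromy g ⟨y₁, hy₁⟩ : unitDisc) =
      hp.isCoveringMap.monodromy g' ⟨y₁, hy₁⟩) : g = g' := by
  subst hy₁
  obtain ⟨γ⟩ := g
  obtain ⟨γ'⟩ := g'
  have cov := hp.isCoveringMap
  -- The two lifts share both endpoints, so they are homotopic in the disc, and the homotopy
  -- projects to `Ω`.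
  let Γ : Path y₁ (cov.liftPath γ y₁ γ.source 1) :=
    ⟨cov.liftPath γ y₁ γ.source, cov.liftPath_zero _ _ _, rfl⟩
  let Γ' : Path y₁ (cov.liftPath γ y₁ γ.source 1) :=
    ⟨cov.liftPath γ' y₁ γ'.source, cov.liftPath_zero _ _ _, h.symm⟩
  refine Path.Homotopic.Quotient.eq.mpr ?_
  have hom := ContinuousMap.HomotopicRel.comp_continuousMap
    (SimplyConnectedSpace.paths_homotopic Γ Γ') ⟨p, cov.continuous⟩
  have e1 : (⟨p, cov.continuous⟩ : C(unitDisc, Ω)).comp Γ.toContinuousMap = γ.toContinuousMap :=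
    ContinuousMap.ext fun t ↦ congrFun (cov.liftPath_lifts γ y₁ γ.source) t
  have e2 : (⟨p, cov.continuous⟩ : C(unitDisc, Ω)).comp Γ'.toContinuousMap = γ'.toContinuousMap :=
    ContinuousMap.ext fun t ↦ congrFun (cov.liftPath_lifts γ' y₁ γ'.source) t
  rw [e1, e2] at hom
  exact hom

/-- A deck transformation carries lifts to lifts, and a lift is determined by its starting point. -/
theorem deck_monodromy (hp : IsDiscUniversalCovering p) (σ : Deck p) {y : unitDisc}
    (hy : p y = z₁) (g : FundamentalGroup Ω z₁) :
    (hp.isCoveringMap.monodromy g ⟨σ.toEquiv y, (σ.comp_eq y).trans hy⟩ : unitDisc) =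
      σ.toEquiv (hp.isCoveringMap.monodromy g ⟨y, hy⟩) := by
  obtain ⟨γ⟩ := g
  have cov := hp.isCoveringMap
  have h0 : γ 0 = p (σ.toEquiv y) := γ.source.trans ((σ.comp_eq y).trans hy).symm
  have h0' : γ 0 = p y := γ.source.trans hy.symm
  have : (⟨σ.toEquiv, σ.holomorphic.continuous⟩ : C(unitDisc, unitDisc)).comp
      (cov.liftPath γ y h0') = cov.liftPath γ (σ.toEquiv y) h0 := by
    refine (cov.eq_liftPath_iff' h0).mpr ⟨funext fun t ↦ ?_, ?_⟩
    · exact (σ.comp_eq _).trans (congrFun (cov.liftPath_lifts γ y h0') t)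
    · exact congrArg σ.toEquiv (cov.liftPath_zero _ _ _)
  exact (DFunLike.congr_fun this 1).symm

theorem exists_deckToFundamentalGroup_eq [IsManifold 𝓘(ℂ) ω Ω] (hp : IsDiscUniversalCovering p)
    (hy₁ : p y₁ = z₁) (g : FundamentalGroup Ω z₁) :
    ∃ σ : Deck p, deckToFundamentalGroup hp hy₁ σ = g ∧
      σ.toEquiv y₁ = hp.isCoveringMap.monodromy g ⟨y₁, hy₁⟩ := by
  obtain ⟨σ, hσ⟩ := hp.exists_deck (y := y₁) (y' := hp.isCoveringMap.monodromy g ⟨y₁, hy₁⟩)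
    ((hp.isCoveringMap.monodromy g ⟨y₁, hy₁⟩).2.trans hy₁.symm)
  exact ⟨σ, eq_of_monodromy_eq hp hy₁ (by rw [monodromy_deckToFundamentalGroup, hσ]), hσ⟩

/-! ### Characters -/

theorem existsUnique_isCharacterOf [IsManifold 𝓘(ℂ) ω Ω] (hp : IsDiscUniversalCovering p)
    (hy₁ : p y₁ = z₁) {w : Ω → ℝ} (hw : IsHolomorphicModulus w) :
    ∃! χ : FundamentalGroup Ω z₁ →* Circle, IsCharacterOf hp hy₁ w χ := by
  obtain ⟨f, hf, hfw⟩ := hw.exists_holomorphic hp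
  obtain ⟨y₀, hy₀⟩ := hw.exists_ne_zero hp
  have hf0 : f y₀ ≠ 0 := norm_ne_zero_iff.mp (by rwa [hfw])
  have hc : ∀ σ : Deck p, ∃ c : Circle, ∀ y, f (σ.toEquiv y) = c * f y := fun σ ↦ by
    obtain ⟨c, hc, h⟩ := exists_unimodular_mul_of_norm_eq_unitDisc
      (hf.comp σ.holomorphic) hf fun y ↦ by
        rw [Function.comp_apply, hfw, hfw, σ.comp_eq]
    exact ⟨⟨c, mem_sphere_zero_iff_norm.mpr hc⟩, h⟩
  choose c hc using hc
  choose s hs hsy using exists_deckToFundamentalGroup_eq hp hy₁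
  have hmul : ∀ g g', c (s (g * g')) = c (s g) * c (s g') := fun g g' ↦ by
    -- The product `g * g'` traverses `g'` first, so `s` reverses products; this is harmless because
    -- `c` takes values in a commutative group.
    have h1 : ∀ y, (s (g * g')).toEquiv y = (s g').toEquiv ((s g).toEquiv y) := by
      refine congrFun (hp.isCoveringMap.eq_of_comp_eq (s (g * g')).holomorphic.continuous
        ((s g').holomorphic.continuous.comp (s g).holomorphic.continuous) (funext fun x ↦ ?_) y₁ ?_)
      · simp [Deck.comp_eq]
      · have h1 := congrArg Subtype.val
          (hp.isCoveringMap.monodromy_trans_apply g'.toPath g.toPath ⟨y₁, hy₁⟩)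
        have h2 : hp.isCoveringMap.monodromy g'.toPath ⟨y₁, hy₁⟩ =
            ⟨(s g').toEquiv y₁, ((s g').comp_eq y₁).trans hy₁⟩ := Subtype.ext (hsy g').symm
        rw [h2] at h1
        refine (hsy (g * g')).trans (h1.trans ((deck_monodromy hp (s g') hy₁ g).trans ?_))
        exact congrArg (s g').toEquiv (hsy g).symm
    have h2 := hc (s (g * g')) y₀
    rw [h1, hc, hc, ← mul_assoc, mul_comm (c (s g') : ℂ)] at h2
    ext
    exact (mul_right_cancel₀ hf0 h2).symm
  refine ⟨MonoidHom.mk' (fun g ↦ c (s g)) hmul, ⟨f, hf, hfw, fun σ y ↦ ?_⟩,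
    fun χ ⟨f', hf', hfw', h⟩ ↦ ?_⟩
  · have : s (deckToFundamentalGroup hp hy₁ σ) = σ := Deck.ext_of_apply_eq hp (y := y₁) <| by
      rw [hsy, monodromy_deckToFundamentalGroup]
    rw [MonoidHom.mk'_apply, this, hc]
  · obtain ⟨a, ha, haf⟩ := exists_unimodular_mul_of_norm_eq_unitDisc hf' hf
      fun y ↦ by rw [hfw, hfw']
    have ha0 : a ≠ 0 := norm_ne_zero_iff.mp (by simp [ha])
    ext g
    have h1 := h (s g) y₀
    rw [hs, haf, haf, hc, ← mul_assoc, mul_comm a, mul_assoc] at h1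
    exact (mul_right_cancel₀ (mul_ne_zero ha0 hf0) h1).symm

end Deck

/-! ### Variation of a holomorphic function along a path -/

/-- The solution of the linear differential equation `φ' = q φ`. -/
theorem eq_mul_exp_integral_of_hasDerivAt {φ q : ℝ → ℂ} {a b : ℝ} (hab : a ≤ b)
    (hq : Continuous q) (hφ : ContinuousOn φ (Icc a b))
    (hd : ∀ t ∈ Ioo a b, HasDerivAt φ (q t * φ t) t) :
    φ b = φ a * Complex.exp (∫ t in a..b, q t) := by
  have hQ : ∀ t, HasDerivAt (fun s ↦ ∫ x in a..s, q x) (q t) t :=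
    fun t ↦ (hq.integral_hasStrictDerivAt a t).hasDerivAt
  have hQc : Continuous fun s ↦ ∫ x in a..s, q x :=
    continuous_iff_continuousAt.mpr fun t ↦ (hQ t).continuousAt
  have hd0 : ∀ t ∈ Ioo a b,
      HasDerivAt (fun t ↦ φ t * Complex.exp (-∫ x in a..t, q x)) 0 t := fun t ht ↦ by
    have h := (hd t ht).mul (hQ t).fun_neg.cexp
    rwa [show q t * φ t * Complex.exp (-∫ x in a..t, q x) +
      φ t * (Complex.exp (-∫ x in a..t, q x) * -q t) = 0 by ring] at h
  have h := intervalIntegral.integral_eq_sub_of_hasDerivAt_of_le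
    (f := fun t ↦ φ t * Complex.exp (-∫ x in a..t, q x)) hab
    (hφ.mul (Complex.continuous_exp.comp hQc.neg).continuousOn) hd0 (by simp)
  simp only [intervalIntegral.integral_zero, intervalIntegral.integral_same, neg_zero,
    Complex.exp_zero, mul_one] at h
  rw [← sub_eq_zero.mp h.symm, mul_assoc, ← Complex.exp_add, neg_add_cancel, Complex.exp_zero,
    mul_one]

/-- The change of argument of a nonvanishing `C¹` function is the integral of the imaginary part
of its logarithmic derivative. -/
theorem eq_mul_exp_integral_im {φ k : ℝ → ℂ} {a b : ℝ} (hab : a ≤ b)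
    (hφ : ContDiffOn ℝ 1 φ (Icc a b)) (h0 : ∀ t, φ t ≠ 0)
    (hk : ∀ t ∈ Ioo a b, ∃ d : ℂ, HasDerivAt φ (d * φ t) t ∧ k t = d.im) :
    IntervalIntegrable k MeasureTheory.volume a b ∧
      ∃ ρ : ℝ, φ b = φ a * Complex.exp (ρ + Complex.I * ∫ t in a..b, k t) := by
  rcases hab.eq_or_lt with rfl | hlt
  · exact ⟨by simp, 0, by simp⟩
  -- The logarithmic derivative, one-sided at the end points, is extended by constants to a
  -- continuous function on the line.
  set q : ℝ → ℂ := IccExtend hab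
    ((Icc a b).domRestrict fun t ↦ derivWithin φ (Icc a b) t / φ t) with hq
  have hqc : Continuous q := by
    refine Continuous.Icc_extend' (continuousOn_iff_continuous_domRestrict.mp ?_)
    exact (hφ.continuousOn_derivWithin (uniqueDiffOn_Icc hlt) le_rfl).div hφ.continuousOn
      fun t _ ↦ h0 t
  have hqd : ∀ t ∈ Ioo a b, HasDerivAt φ (q t * φ t) t ∧ k t = (q t).im := by
    intro t ht
    obtain ⟨d, hd, hkd⟩ := hk t ht
    have : q t = d := by
      have ht' := Ioo_subset_Icc_self ht
      rw [hq, IccExtend_of_mem _ _ ht', domRestrict_apply,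
        hd.hasDerivWithinAt.derivWithin (uniqueDiffOn_Icc hlt t ht'),
        mul_div_cancel_right₀ _ (h0 t)]
    rw [this]
    exact ⟨hd, hkd⟩
  -- `k` is controlled only in the open interval; the end point `b` is a null set.
  have hae : ∀ᵐ t, t ∈ uIoc a b → ((q t).im : ℂ) = k t := by
    rw [uIoc_of_le hab]
    filter_upwards [MeasureTheory.Measure.ae_ne MeasureTheory.volume b] with t htb ht
    exact (hqd t ⟨ht.1, lt_of_le_of_ne ht.2 htb⟩).2.symm
  have him : Continuous fun t ↦ ((q t).im : ℂ) := by fun_prop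
  refine ⟨(him.intervalIntegrable a b).congr_ae
    ((MeasureTheory.ae_restrict_iff' measurableSet_uIoc).mpr hae), (∫ t in a..b, q t).re, ?_⟩
  rw [eq_mul_exp_integral_of_hasDerivAt hab hqc hφ.continuousOn fun t ht ↦ (hqd t ht).1,
    ← intervalIntegral.integral_congr_ae hae]
  have : ∫ t in a..b, ((q t).im : ℂ) = ((∫ t in a..b, q t).im : ℝ) := by
    rw [intervalIntegral.integral_ofReal]
    congr 1
    exact Complex.imCLM.intervalIntegral_comp_comm (hqc.intervalIntegrable a b)
  rw [this, mul_comm Complex.I, Complex.re_add_im]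

theorem eq_mul_exp_integral_im_of_piecewise {φ k : ℝ → ℂ} {t : ℕ → ℝ} (ht : Monotone t) {n : ℕ}
    (h0 : ∀ s, φ s ≠ 0) (hφ : ∀ i < n, ContDiffOn ℝ 1 φ (Icc (t i) (t (i + 1))))
    (hk : ∀ i < n, ∀ s ∈ Ioo (t i) (t (i + 1)), ∃ d : ℂ, HasDerivAt φ (d * φ s) s ∧ k s = d.im) :
    IntervalIntegrable k MeasureTheory.volume (t 0) (t n) ∧
      ∃ ρ : ℝ, φ (t n) = φ (t 0) * Complex.exp (ρ + Complex.I * ∫ s in t 0..t n, k s) := by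
  induction n with
  | zero => exact ⟨by simp, 0, by simp⟩
  | succ n ih =>
    obtain ⟨h1, ρ, h2⟩ := ih (fun i hi ↦ hφ i (hi.trans n.lt_succ_self))
      fun i hi ↦ hk i (hi.trans n.lt_succ_self)
    obtain ⟨h3, ρ', h4⟩ := eq_mul_exp_integral_im (ht n.le_succ) (hφ n n.lt_succ_self) h0
      (hk n n.lt_succ_self)
    refine ⟨h1.trans h3, ρ + ρ', ?_⟩
    rw [h4, h2, ← intervalIntegral.integral_add_adjacent_intervals h1 h3, mul_assoc,
      ← Complex.exp_add]
    congr 2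
    push_cast
    ring

/-! ### The form `d̃h` along lifted loops -/

section RiemannSurface

variable {Ω : Type*} [TopologicalSpace Ω] [ChartedSpace ℂ Ω]

/-- `d̃h` is the imaginary part of `dF` if `h = Re F`. -/
theorem dTilde_eq_im {h : Ω → ℝ} {z : Ω} {F : ℂ → ℂ}
    (hF : AnalyticAt ℂ F (chartAt ℂ z z))
    (h1 : ∀ᶠ x in 𝓝 (chartAt ℂ z z), (F x).re = h ((chartAt ℂ z).symm x))
    (h2 : ∀ᶠ x in 𝓝 z, (F (chartAt ℂ z x)).re = h x) (v : TangentSpace 𝓘(ℝ, ℂ) z) :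
    dTilde h z v = ((deriv F (chartAt ℂ z z) * (show ℂ from v)).im : ℂ) := by
  have hd : HasFDerivAt (fun x ↦ h ((chartAt ℂ z).symm x))
      (Complex.reCLM.comp ((ContinuousLinearMap.toSpanSingleton ℂ
        (deriv F (chartAt ℂ z z))).restrictScalars ℝ)) (chartAt ℂ z z) :=
    (Complex.reCLM.hasFDerivAt.comp (chartAt ℂ z z)
      (hF.differentiableAt.hasDerivAt.hasFDerivAt.restrictScalars ℝ)).congr_of_eventuallyEq
      (h1.mono fun x hx ↦ hx.symm)
  have hc : ContinuousAt h z :=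
    (Complex.continuous_re.continuousAt.comp (hF.continuousAt.comp
      (tendsto_chartAt z))).congr h2
  have hm : HasMFDerivAt 𝓘(ℝ, ℂ) 𝓘(ℝ, ℝ) h z
      (Complex.reCLM.comp ((ContinuousLinearMap.toSpanSingleton ℂ
        (deriv F (chartAt ℂ z z))).restrictScalars ℝ)) :=
    ⟨hc, hd.hasFDerivWithinAt⟩
  have hr : ∀ v : TangentSpace 𝓘(ℝ, ℂ) z, realDifferential h z v =
      ((show ℂ from v) * deriv F (chartAt ℂ z z)).re := fun v ↦ by
    rw [realDifferential, hm.mfderiv]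
    rfl
  rw [dTilde, del, delBar, hr, hr]
  -- The difference `∂h - ∂̄h` is `-i dh(i·)`; division by `i` leaves `-dh(iv) = -Re(i d v) = Im(d
  -- v)`, where `d` is the derivative of `F`.
  have key : ∀ v d : ℂ, ((((v * d).re : ℂ) - Complex.I * (Complex.I * v * d).re) / 2 -
      (((v * d).re : ℂ) + Complex.I * (Complex.I * v * d).re) / 2) / Complex.I = (d * v).im := by
    intro v d
    rw [mul_assoc Complex.I, Complex.I_mul_re, Complex.ofReal_neg, mul_comm d]
    field_simp
    ring
  exact key v _

/-- The velocity vector is the derivative in the local coordinate. -/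
theorem hasDerivAt_chart_velocity {a b : Ω} {γ : Path a b} {t : ℝ}
    (h : MDifferentiableAt 𝓘(ℝ, ℝ) 𝓘(ℝ, ℂ) γ.extend t) :
    HasDerivAt (fun s ↦ chartAt ℂ (γ.extend t) (γ.extend s)) (show ℂ from velocity γ t) t := by
  have h1 := h.hasMFDerivAt.2
  rw [ModelWithCorners.range_eq_univ] at h1
  have h2 : HasFDerivAt (fun s ↦ chartAt ℂ (γ.extend t) (γ.extend s))
      (show ℝ →L[ℝ] ℂ from mfderiv 𝓘(ℝ, ℝ) 𝓘(ℝ, ℂ) γ.extend t) t := hasFDerivWithinAt_univ.mp h1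
  exact h2.hasDerivAt

variable {p : unitDisc → Ω}

/-- Both functions are holomorphic near `y` with modulus `exp (h ∘ p)`, and the exponential has no
zeros. -/
theorem eventually_eq_mul_exp_of_lift [IsManifold 𝓘(ℂ) ω Ω] (hp : IsDiscUniversalCovering p)
    {f : unitDisc → ℂ} (hf : MDifferentiable 𝓘(ℂ) 𝓘(ℂ) f) {h : Ω → ℝ} {z : Ω} {F : ℂ → ℂ}
    (hF : AnalyticAt ℂ F (chartAt ℂ z z)) (hFh : ∀ᶠ x in 𝓝 z, (F (chartAt ℂ z x)).re = h x)
    {y : unitDisc} (hy : p y = z) (hfh : ∀ᶠ x in 𝓝 y, ‖f x‖ = Real.exp (h (p x))) :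
    ∃ c : ℂ, ∀ᶠ x in 𝓝 y, f x = c * Complex.exp (F (chartAt ℂ z (p x))) := by
  have ht : Tendsto (fun x ↦ p (discRetract x)) (𝓝 (y : ℂ)) (𝓝 z) :=
    hy ▸ hp.isCoveringMap.continuous.continuousAt.tendsto.comp (tendsto_discRetract y)
  have hFa : AnalyticAt ℂ (fun x ↦ Complex.exp (F (chartAt ℂ z (p (discRetract x))))) (y : ℂ) := by
    refine (AnalyticAt.fun_comp (g := F) (by simpa [hy] using hF) (hp.analyticAt_chart ?_)).cexp
    rw [hy]
    exact mem_chart_source ℂ z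
  obtain ⟨c, -, hc⟩ := ((mdifferentiable_unitDisc_iff.mp hf).analyticAt
    (ball_mem_nhds_coe y)).exists_unimodular_mul_of_norm_eq hFa (Complex.exp_ne_zero _) (by
      filter_upwards [(tendsto_discRetract y).eventually hfh, ht.eventually hFh] with x h1 h2
      rw [Function.comp_apply, h1, Complex.norm_exp, h2])
  refine ⟨c, ?_⟩
  rw [nhds_coe_unitDisc, eventually_map] at hc
  simpa using hc

/-- The change of a holomorphic function on the disc of modulus `exp h` along the lift of a loop is
determined by the integral of `d̃h`. -/
theorem lift_apply_one_eq [IsManifold 𝓘(ℂ) ω Ω] (hp : IsDiscUniversalCovering p)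
    {f : unitDisc → ℂ} (hf : MDifferentiable 𝓘(ℂ) 𝓘(ℂ) f) {h : Ω → ℝ} {V : Set Ω}
    (hV : IsOpen V) (hh : IsHarmonicOn h V) (hfh : ∀ y, p y ∈ V → ‖f y‖ = Real.exp (h (p y)))
    {z₁ : Ω} {γ : Path z₁ z₁} (hγ : IsPiecewiseSmooth γ) (hγV : range γ ⊆ V)
    {Γ : C(unitInterval, unitDisc)} (hΓ : ∀ t, p (Γ t) = γ t) :
    f (Γ 1) = Complex.exp (Complex.I * integralDTilde h γ) * f (Γ 0) := by
  set Γ' : ℝ → unitDisc := fun t ↦ Γ (projIcc 0 1 zero_le_one t) with hΓ'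
  have hΓc : Continuous Γ' := Γ.continuous.comp continuous_projIcc
  have hpΓ : ∀ t, p (Γ' t) = γ.extend t := fun t ↦ hΓ _
  have hmem : ∀ t, γ.extend t ∈ V := fun t ↦ hγV ⟨projIcc 0 1 zero_le_one t, rfl⟩
  have hnorm : ∀ t, ‖f (Γ' t)‖ = Real.exp (h (γ.extend t)) := fun t ↦ by
    rw [hfh _ (by rw [hpΓ]; exact hmem t), hpΓ]
  have h0 : ∀ t, f (Γ' t) ≠ 0 := fun t ↦
    norm_ne_zero_iff.mp (by rw [hnorm]; exact (Real.exp_pos _).ne')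
  -- `F` and `c` depend on `t`, but `c` drops out of the logarithmic derivative.
  have hloc : ∀ t, ∃ (F : ℂ → ℂ) (c : ℂ),
      AnalyticAt ℂ F (chartAt ℂ (γ.extend t) (γ.extend t)) ∧
      (∀ v, dTilde h (γ.extend t) v =
        ((deriv F (chartAt ℂ (γ.extend t) (γ.extend t)) * (show ℂ from v)).im : ℂ)) ∧
      ∀ᶠ s in 𝓝 t, f (Γ' s) =
        c * Complex.exp (F (chartAt ℂ (γ.extend t) (γ.extend s))) := fun t ↦ by
    obtain ⟨F, hF, hF1, hF2⟩ := hh.exists_re_eq (hmem t)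
    have hV' : ∀ᶠ x in 𝓝 (Γ' t), ‖f x‖ = Real.exp (h (p x)) := by
      have : p ⁻¹' V ∈ 𝓝 (Γ' t) := (hV.preimage hp.isCoveringMap.continuous).mem_nhds
        (by rw [mem_preimage, hpΓ]; exact hmem t)
      filter_upwards [this] with x hx using hfh x hx
    obtain ⟨c, hc⟩ := eventually_eq_mul_exp_of_lift hp hf hF hF2 (hpΓ t) hV'
    refine ⟨F, c, hF, dTilde_eq_im hF hF1 hF2, ?_⟩
    filter_upwards [hΓc.continuousAt.eventually hc] with s hs
    rw [hs, hpΓ]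
  obtain ⟨n, t, ht, ht0, htn, hsm⟩ := hγ
  have hC1 : ∀ i < n, ContDiffOn ℝ 1 (fun s ↦ f (Γ' s)) (Icc (t i) (t (i + 1))) := by
    intro i hi s hs
    obtain ⟨F, c, hF, -, hc⟩ := hloc s
    have h1 := ((contMDiffWithinAt_iff.mp (hsm i hi s hs)).2)
    simp only [mfld_simps] at h1
    have h2 : ContDiffWithinAt ℝ 1
        (fun x ↦ c * Complex.exp (F (chartAt ℂ (γ.extend s) (γ.extend x))))
        (Icc (t i) (t (i + 1))) s := by
      have hF' : ContDiffAt ℝ 1 F (chartAt ℂ (γ.extend s) (γ.extend s)) :=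
        (hF.contDiffAt (n := 1)).restrict_scalars ℝ
      exact contDiffWithinAt_const.mul (hF'.comp_contDiffWithinAt s h1).cexp
    exact h2.congr_of_eventuallyEq (hc.filter_mono nhdsWithin_le_nhds) hc.self_of_nhds
  have hder : ∀ i < n, ∀ s ∈ Ioo (t i) (t (i + 1)), ∃ d : ℂ,
      HasDerivAt (fun s ↦ f (Γ' s)) (d * f (Γ' s)) s ∧
        dTilde h (γ.extend s) (velocity γ s) = d.im := by
    intro i hi s hs
    obtain ⟨F, c, hF, hd, hc⟩ := hloc s
    have h1 : MDifferentiableAt 𝓘(ℝ, ℝ) 𝓘(ℝ, ℂ) γ.extend s :=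
      ((hsm i hi s (Ioo_subset_Icc_self hs)).contMDiffAt
        (Icc_mem_nhds hs.1 hs.2)).mdifferentiableAt one_ne_zero
    refine ⟨_, ?_, hd _⟩
    have h2 := (hF.differentiableAt.hasDerivAt.comp_of_eq s (hasDerivAt_chart_velocity h1) rfl)
    have h3 := (h2.cexp.const_mul c).congr_of_eventuallyEq hc
    refine h3.congr_deriv ?_
    rw [hc.self_of_nhds, Function.comp_apply]
    ring
  obtain ⟨-, ρ, hρ⟩ := eq_mul_exp_integral_im_of_piecewise ht h0 hC1 hder
  rw [ht0, htn] at hρ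
  -- The integral is real, so its exponential factor is unimodular; as `γ` is closed, `f` has equal
  -- moduli at both ends and `ρ` vanishes.
  have hint : ((integralDTilde h γ).im : ℝ) = 0 := by
    have : integralDTilde h γ =
        ((∫ s in (0 : ℝ)..1, (dTilde h (γ.extend s) (velocity γ s)).re : ℝ) : ℂ) := by
      rw [integralDTilde, ← intervalIntegral.integral_ofReal]
      congr 1
      ext s
      obtain ⟨F, c, -, hd, -⟩ := hloc s
      rw [hd, Complex.ofReal_re]
    rw [this, Complex.ofReal_im]
  change f (Γ' 1) = f (Γ' 0) * Complex.exp (ρ + Complex.I * integralDTilde h γ) at hρ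
  have hn := congrArg norm hρ
  rw [norm_mul, hnorm, hnorm, γ.extend_one, γ.extend_zero, Complex.norm_exp] at hn
  have hρ0 : ρ = 0 := by
    have := (Real.exp_eq_one_iff _).mp
      (mul_left_cancel₀ (Real.exp_pos _).ne' (hn.symm.trans (mul_one _).symm))
    simpa [hint] using this
  rw [hρ0, Complex.ofReal_zero, zero_add, mul_comm] at hρ
  simpa [hΓ'] using hρ

end RiemannSurface

/-! ### Values of characters on loops -/

section RiemannSurface

variable {Ω : Type*} [TopologicalSpace Ω] [ChartedSpace ℂ Ω] {p : unitDisc → Ω}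

/-- The value of a character with modulus `exp h` on a loop in the domain of harmonicity of `h`. -/
theorem IsCharacterOf.apply_eq_exp_integralDTilde [IsManifold 𝓘(ℂ) ω Ω]
    {hp : IsDiscUniversalCovering p} {z₁ : Ω} {y₁ : unitDisc} {hy₁ : p y₁ = z₁} {w : Ω → ℝ}
    {χ : FundamentalGroup Ω z₁ →* Circle} (hχ : IsCharacterOf hp hy₁ w χ) {h : Ω → ℝ} {V : Set Ω}
    (hV : IsOpen V) (hh : IsHarmonicOn h V) (hw : ∀ z ∈ V, w z = Real.exp (h z))
    {γ : Path z₁ z₁} (hγ : IsPiecewiseSmooth γ) (hγV : range γ ⊆ V) :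
    (χ (FundamentalGroup.fromPath (Path.Homotopic.Quotient.mk γ)) : ℂ) =
      Complex.exp (Complex.I * integralDTilde h γ) := by
  obtain ⟨f, hf, hfw, hfχ⟩ := hχ
  have h0 : γ 0 = p y₁ := γ.source.trans hy₁.symm
  obtain ⟨σ, hσ, hσy⟩ := exists_deckToFundamentalGroup_eq hp hy₁
    (FundamentalGroup.fromPath (Path.Homotopic.Quotient.mk γ))
  -- The lift ends at `σ(y₁)`, so the change of `f` along it is exactly the factor `χ(Φ(σ))`.
  have hend : σ.toEquiv y₁ = hp.isCoveringMap.liftPath γ y₁ h0 1 := hσy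
  have hmain := lift_apply_one_eq hp hf hV hh (fun y hy ↦ by rw [hfw, hw _ hy]) hγ hγV
    (Γ := hp.isCoveringMap.liftPath γ y₁ h0)
    fun t ↦ congrFun (hp.isCoveringMap.liftPath_lifts γ y₁ h0) t
  rw [← hend, hfχ, hσ, hp.isCoveringMap.liftPath_zero] at hmain
  refine mul_right_cancel₀ (norm_ne_zero_iff.mp ?_) hmain
  rw [hfw, hy₁, hw z₁ (hγV ⟨0, γ.source⟩)]
  exact (Real.exp_pos _).ne'

end RiemannSurface

end

theorem mainTheorem8 {Ω : Type*} [TopologicalSpace Ω] [T2Space Ω] [ConnectedSpace Ω]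
    [ChartedSpace ℂ Ω] [IsManifold 𝓘(ℂ) ω Ω]
    (p : unitDisc → Ω) (hp : IsDiscUniversalCovering p)
    (z₁ : Ω) (y₁ : unitDisc) (hy₁ : p y₁ = z₁)
    (z₀ : Ω) (G : Ω → ℝ) (hG : IsGreenFunction z₀ G)
    (u : Ω → ℝ) (hu : IsHarmonicOn u Set.univ) :
    ((∃! χ : FundamentalGroup Ω z₁ →* Circle, IsCharacterOf hp hy₁ (expWithPole z₀ G) χ) ∧
      ∀ χ : FundamentalGroup Ω z₁ →* Circle, IsCharacterOf hp hy₁ (expWithPole z₀ G) χ →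
        ∀ γ : Path z₁ z₁, IsPiecewiseSmooth γ → z₀ ∉ Set.range γ →
          (χ (FundamentalGroup.fromPath (Path.Homotopic.Quotient.mk γ)) : ℂ) =
            Complex.exp (Complex.I * integralDTilde G γ)) ∧
    ((∃! χ : FundamentalGroup Ω z₁ →* Circle,
        IsCharacterOf hp hy₁ (fun z => Real.exp (u z)) χ) ∧
      ∀ χ : FundamentalGroup Ω z₁ →* Circle,
        IsCharacterOf hp hy₁ (fun z => Real.exp (u z)) χ →
        ∀ γ : Path z₁ z₁, IsPiecewiseSmooth γ →
          (χ (FundamentalGroup.fromPath (Path.Homotopic.Quotient.mk γ)) : ℂ) =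
            Complex.exp (Complex.I * integralDTilde u γ)) := by
  have hGw := isHolomorphicModulus_expWithPole hG.toIsNegHarmonicWithLogPole
  have huw := isHolomorphicModulus_exp hu
  exact ⟨⟨existsUnique_isCharacterOf hp hy₁ hGw, fun χ hχ γ hγ hz ↦
      hχ.apply_eq_exp_integralDTilde isOpen_compl_singleton hG.harmonic
        (fun z hz ↦ expWithPole_of_ne G hz) hγ (Set.subset_compl_singleton_iff.mpr hz)⟩,
    ⟨existsUnique_isCharacterOf hp hy₁ huw, fun χ hχ γ hγ ↦
      hχ.apply_eq_exp_integralDTilde isOpen_univ hu (fun _ _ ↦ rfl) hγ (Set.subset_univ _)⟩⟩
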